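/- Let $X$ be a metric space whose completion $\tilde X$ is not locally compact. Then $$\operatorname{cof}(\mathrm{PK}(X)) \;=\; d(X)\cdot\mathfrak d\cdot\sup_{\tilde x\in\tilde X}\operatorname{cof}\bigl([\mathrm{ld}(\tilde x)]^{\aleph_0}\bigr).$$ Here, for a partially ordered set $P$, $\operatorname{cof}(P)$ is the minimal cardinality of a cofinal subset of $P$ (a set $C\subseteq P$ such that every $p\in P$ satisfies $p\le c$ for some $c\in C$); $\mathrm{PK}(X)$ is the family of precompact (totally bounded) subsets of $X$, ordered by inclusion; the density $d(Y)$ of a topological space $Y$ is the minimal cardinality of a dense subset of $Y$; the local density $\mathrm{ld}(\tilde x)$ of a point $\tilde x\in\tilde X$ is the minimal density of a neighborhood of $\tilde x$ in $\tilde X$ (with the subspace topology); $\mathfrak d=\operatorname{cof}(\mathbb N^{\mathbb N},\le)$, where $f\le g$ means $f(n)\le g(n)$ for all $n$; and, for a cardinal number $\kappa$, $[\kappa]^{\aleph_0}$ is the family of countably infinite subsets of $\kappa$, ordered by inclusion (for finite $\kappa$ this family is empty and its cofinality is $0$, so points of finite local density do not contribute to the supremum). -/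

import Mathlib

open Cardinal

universe u

noncomputable section

/-- The density of a topological space: the minimal cardinality of a dense subset. -/
def density (X : Type u) [TopologicalSpace X] : Cardinal.{u} :=
  ⨅ s : {s : Set X // Dense s}, #s.1

/-- The local density of a point: the minimal density of a neighborhood of the point, where the
neighborhood carries the subspace topology. -/
def localDensity {X : Type u} [TopologicalSpace X] (x : X) : Cardinal.{u} :=
  ⨅ U : {U : Set X // U ∈ nhds x}, density U.1

/-- The family of precompact (that is, totally bounded) subsets of a metric space.
As a subtype of `Set X`, it is ordered by inclusion. -/
abbrev PrecompactSets (X : Type u) [MetricSpace X] : Type u :=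
  {P : Set X // TotallyBounded P}

/-- The family of all countably infinite subsets of (a set of cardinality) `κ`.
As a subtype of `Set κ.out`, it is ordered by inclusion. It is empty if `κ` is finite. -/
abbrev CountablyInfiniteSubsets (κ : Cardinal.{u}) : Type u :=
  {A : Set κ.out // #A = ℵ₀}

/-- The dominating number: the cofinality of the set of functions from `ℕ` to `ℕ`,
ordered by `f ≤ g` if `f n ≤ g n` for all `n`. -/
def dominatingNumber : Cardinal.{0} :=
  Order.cof (ℕ → ℕ)

end

-- Lower bound: each factor is at most `Order.cof (PrecompactSets X)`, which is infinite, so their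
-- product is too. Countable dense subsets of the members of a cofinal family together form a dense
-- set, giving `density X`. The other two factors come from Tukey maps: near a point of the
-- completion, finite sets in shrinking balls have precompact union, and they can code a function
-- (if the point has no compact neighborhood) or a countable set of indices.
--
-- Upper bound: a precompact subset of `U` lies in a `tube` coded by a function and a countable part
-- of a dense subset of `U` (`exists_dominating_family`). A precompact set has compact closure in
-- the completion, so finitely many small balls centred in a dense subset of `X` cover it; finite
-- unions of tubes therefore suffice.

universe v

open Set Filter Topology

/-! ### Cofinality and Tukey maps -/

section Cofinality

variable {α : Type u} {β : Type v} [Preorder α] [Preorder β]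

/-- A Tukey connection bounds cofinalities. -/
theorem lift_cof_le_of_tukey (f : α → β) (g : β → α) (h : ∀ a b, f a ≤ b → a ≤ g b) :
    Cardinal.lift.{v} (Order.cof α) ≤ Cardinal.lift.{u} (Order.cof β) := by
  obtain ⟨s, hs, hcard⟩ := Order.exists_cof_eq (α := β)
  have hcof : IsCofinal (g '' s) := fun a => by
    obtain ⟨b, hb, hab⟩ := hs (f a)
    exact ⟨g b, mem_image_of_mem g hb, h a b hab⟩
  rw [← hcard]
  exact (Cardinal.lift_le.2 (Order.cof_le hcof)).trans mk_image_le_lift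

theorem aleph0_le_dominatingNumber : ℵ₀ ≤ dominatingNumber := by
  have h := lift_cof_le_of_tukey (α := ℕ) (β := ℕ → ℕ) (fun n _ => n) (fun f => f 0)
    fun _ _ h => h 0
  rwa [Cardinal.lift_id, Cardinal.lift_id, Order.cof_nat] at h

end Cofinality

/-! ### Density and local density -/

section Density

variable {X : Type u} [TopologicalSpace X]

theorem exists_dense_mk_eq_density (X : Type u) [TopologicalSpace X] :
    ∃ s : Set X, Dense s ∧ #s = density X := by
  have : Nonempty {s : Set X // Dense s} := ⟨⟨univ, dense_univ⟩⟩
  obtain ⟨s, hs⟩ := ciInf_mem (fun s : {s : Set X // Dense s} => #s.1)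
  exact ⟨s.1, s.2, hs⟩

theorem density_le_mk {s : Set X} (hs : Dense s) : density X ≤ #s :=
  ciInf_le' (fun s : {s : Set X // Dense s} => #s.1) ⟨s, hs⟩

theorem exists_nhds_density_eq_localDensity (x : X) :
    ∃ U ∈ 𝓝 x, density U = localDensity x := by
  have : Nonempty {U : Set X // U ∈ 𝓝 x} := ⟨⟨univ, univ_mem⟩⟩
  obtain ⟨U, hU⟩ := ciInf_mem (fun U : {U : Set X // U ∈ 𝓝 x} => density U.1)
  exact ⟨U.1, U.2, hU⟩

theorem localDensity_le_density {x : X} {U : Set X} (hU : U ∈ 𝓝 x) :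
    localDensity x ≤ density U :=
  ciInf_le' (fun U : {U : Set X // U ∈ 𝓝 x} => density U.1) ⟨U, hU⟩

theorem density_coe_le_mk_of_subset_closure {U s : Set X} (hsU : s ⊆ U) (hs : U ⊆ closure s) :
    density U ≤ #s := by
  have hd : Dense ((↑) ⁻¹' s : Set U) := by
    rw [Subtype.dense_iff, Subtype.image_preimage_coe, inter_eq_right.2 hsU]
    exact hs
  refine (density_le_mk hd).trans (mk_preimage_of_injective _ _ Subtype.val_injective)

/-- A subspace contains a dense set indexed by its density. -/
theorem exists_range_subset_closure (U : Set X) :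
    ∃ e : (density U).out → X, range e ⊆ U ∧ U ⊆ closure (range e) := by
  obtain ⟨s, hs, hcard⟩ := exists_dense_mk_eq_density U
  obtain ⟨φ⟩ : Nonempty ((density U).out ≃ s) := Cardinal.eq.1 (by rw [mk_out, hcard])
  have hr : range (fun i => ((φ i : U) : X)) = (↑) '' s := by
    ext y
    constructor
    · rintro ⟨i, rfl⟩
      exact ⟨φ i, (φ i).2, rfl⟩
    · rintro ⟨z, hz, rfl⟩
      exact ⟨φ.symm ⟨z, hz⟩, by simp⟩
  refine ⟨fun i => ((φ i : U) : X), ?_, ?_⟩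
  · rintro _ ⟨i, rfl⟩
    exact (φ i : U).2
  · rw [hr]
    exact Subtype.dense_iff.1 hs

/-- A subspace of finite density is finite. -/
theorem finite_of_density_lt_aleph0 [T1Space X] {U : Set X} (h : density U < ℵ₀) : U.Finite := by
  obtain ⟨e, -, he⟩ := exists_range_subset_closure U
  have : Finite (density U).out := by rwa [← lt_aleph0_iff_finite, mk_out]
  have hf := finite_range e
  rw [hf.isClosed.closure_eq] at he
  exact hf.subset he

end Density

/-! ### Countably infinite subsets of a cardinal -/

section CountablyInfinite

theorem nonempty_equiv_of_mk_eq_aleph0 {α : Type u} {A : Set α} (hA : #A = ℵ₀) :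
    Nonempty (ℕ ≃ A) := by
  obtain ⟨h⟩ := Cardinal.denumerable_iff.2 hA
  exact ⟨(Denumerable.eqv A).symm⟩

/-- An enumeration of a countably infinite set. -/
noncomputable def CountablyInfiniteSubsets.enum {κ : Cardinal.{u}} (A : CountablyInfiniteSubsets κ) (n : ℕ) :
    κ.out :=
  ((nonempty_equiv_of_mk_eq_aleph0 A.2).some n : A.1)

theorem CountablyInfiniteSubsets.exists_enum_eq {κ : Cardinal.{u}}
    (A : CountablyInfiniteSubsets κ) {i : κ.out} (hi : i ∈ A.1) : ∃ n, A.enum n = i :=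
  ⟨(nonempty_equiv_of_mk_eq_aleph0 A.2).some.symm ⟨i, hi⟩, by
    simp [CountablyInfiniteSubsets.enum]⟩

theorem exists_countablyInfiniteSubsets_superset {κ : Cardinal.{u}} (hκ : ℵ₀ ≤ κ)
    {S : Set κ.out} (hS : S.Countable) : ∃ A : CountablyInfiniteSubsets κ, S ⊆ A.1 := by
  have : Infinite κ.out := by rwa [Cardinal.infinite_iff, mk_out]
  have hinf : (range (Infinite.natEmbedding κ.out)).Infinite :=
    infinite_range_of_injective (Infinite.natEmbedding κ.out).injective
  have hc : (S ∪ range (Infinite.natEmbedding κ.out)).Countable :=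
    hS.union (countable_range _)
  refine ⟨⟨S ∪ range (Infinite.natEmbedding κ.out), ?_⟩, subset_union_left⟩
  exact le_antisymm (le_aleph0_iff_set_countable.2 hc)
    (Cardinal.infinite_iff.1 (hinf.mono subset_union_right).to_subtype)

theorem isEmpty_countablyInfiniteSubsets {κ : Cardinal.{u}} (hκ : κ < ℵ₀) :
    IsEmpty (CountablyInfiniteSubsets κ) := by
  refine ⟨fun A => ?_⟩
  have h := mk_set_le A.1
  rw [A.2, mk_out] at h
  exact hκ.not_ge h

end CountablyInfinite

/-! ### Separated nets and totally bounded sets -/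

section Metric

variable {X : Type u} [MetricSpace X]

theorem exists_separated_net (A : Set X) (ε : ℝ) :
    ∃ S ⊆ A, (S.Pairwise fun x y => ε ≤ dist x y) ∧ ∀ a ∈ A, a ∉ S → ∃ s ∈ S, dist a s < ε := by
  obtain ⟨S, hS⟩ := zorn_subset {S : Set X | S ⊆ A ∧ S.Pairwise fun x y => ε ≤ dist x y} (by
    intro c hc hchain
    refine ⟨⋃₀ c, ⟨sUnion_subset fun s hs => (hc hs).1, ?_⟩, fun s hs => subset_sUnion_of_mem hs⟩
    exact (pairwise_sUnion hchain.directedOn).2 fun s hs => (hc hs).2)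
  refine ⟨S, hS.prop.1, hS.prop.2, fun a ha haS => ?_⟩
  by_contra! hcon
  refine haS (hS.le_of_ge (y := insert a S) ⟨insert_subset ha hS.prop.1, ?_⟩
    (subset_insert a S) (mem_insert a S))
  refine hS.prop.2.insert fun b hb _ => ⟨hcon b hb, ?_⟩
  rw [dist_comm]
  exact hcon b hb

/-- A ball of radius `ε / 2` holds at most one point of `S`. -/
theorem TotallyBounded.finite_inter_of_separated {P S : Set X} (hP : TotallyBounded P) {ε : ℝ}
    (hε : 0 < ε) (hS : S.Pairwise fun x y => ε ≤ dist x y) : (S ∩ P).Finite := by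
  obtain ⟨t, ht, hcov⟩ := Metric.totallyBounded_iff.1 hP (ε / 2) (half_pos hε)
  have hsub : S ∩ P ⊆ ⋃ y ∈ t, S ∩ Metric.ball y (ε / 2) := by
    rintro x ⟨hxS, hxP⟩
    obtain ⟨y, hy, hxy⟩ := mem_iUnion₂.1 (hcov hxP)
    exact mem_iUnion₂.2 ⟨y, hy, hxS, hxy⟩
  refine (ht.biUnion fun y _ => Set.Subsingleton.finite ?_).subset hsub
  rintro a ⟨haS, ha⟩ b ⟨hbS, hb⟩
  by_contra hab
  have h1 := hS haS hbS hab
  have h2 := dist_triangle_right a b y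
  rw [Metric.mem_ball] at ha hb
  linarith

theorem exists_infinite_separated_of_not_totallyBounded {A : Set X} (hA : ¬ TotallyBounded A) :
    ∃ ε > 0, ∃ S ⊆ A, S.Infinite ∧ S.Pairwise fun x y => ε ≤ dist x y := by
  by_contra! hcon
  refine hA (Metric.totallyBounded_iff.2 fun ε hε => ?_)
  obtain ⟨S, hSA, hS, hnet⟩ := exists_separated_net A ε
  refine ⟨S, ?_, fun a ha => ?_⟩
  · by_contra hinf
    exact hcon ε hε S hSA hinf hS
  · by_cases haS : a ∈ S
    · exact mem_iUnion₂.2 ⟨a, haS, Metric.mem_ball_self hε⟩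
    · obtain ⟨s, hs, h⟩ := hnet a ha haS
      exact mem_iUnion₂.2 ⟨s, hs, h⟩

/-- Every set has a dense subset that meets each totally bounded set in a countable set. -/
theorem exists_subset_closure_countable_inter (A : Set X) :
    ∃ D ⊆ A, A ⊆ closure D ∧ ∀ P, TotallyBounded P → (D ∩ P).Countable := by
  -- `D` is the union of maximal separated sets at scales `1 / (n + 1)`; each meets `P` in a finite
  -- set.
  choose S hSA hS hnet using fun n : ℕ => exists_separated_net A (1 / ((n : ℝ) + 1))
  refine ⟨⋃ n, S n, iUnion_subset hSA, fun a ha => ?_, fun P hP => ?_⟩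
  · refine Metric.mem_closure_iff.2 fun ε hε => ?_
    obtain ⟨n, hn⟩ := exists_nat_one_div_lt hε
    by_cases haS : a ∈ S n
    · exact ⟨a, mem_iUnion.2 ⟨n, haS⟩, by simpa using hε⟩
    · obtain ⟨s, hs, h⟩ := hnet n a ha haS
      exact ⟨s, mem_iUnion.2 ⟨n, hs⟩, h.trans hn⟩
  · rw [iUnion_inter]
    exact countable_iUnion fun n =>
      (hP.finite_inter_of_separated Nat.one_div_pos_of_nat (hS n)).countable

/-- Finite sets shrinking to a point have a totally bounded union. -/
theorem totallyBounded_iUnion_of_subset_ball (x : X) {s : ℕ → Set X} (hfin : ∀ n, (s n).Finite)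
    (hs : ∀ n, s n ⊆ Metric.ball x (1 / ((n : ℝ) + 1))) : TotallyBounded (⋃ n, s n) := by
  refine Metric.totallyBounded_iff.2 fun ε hε => ?_
  obtain ⟨N, hN⟩ := exists_nat_one_div_lt hε
  refine ⟨insert x (⋃ n ∈ Iio N, s n), ((finite_Iio N).biUnion fun n _ => hfin n).insert x, ?_⟩
  refine iUnion_subset fun n y hy => mem_iUnion₂.2 ?_
  by_cases hn : n < N
  · exact ⟨y, mem_insert_of_mem _ (mem_iUnion₂.2 ⟨n, hn, hy⟩), Metric.mem_ball_self hε⟩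
  · refine ⟨x, mem_insert _ _, ?_⟩
    have h1 : (1 : ℝ) / ((n : ℝ) + 1) ≤ 1 / ((N : ℝ) + 1) :=
      Nat.one_div_le_one_div (not_lt.1 hn)
    exact (Metric.mem_ball.1 (hs n hy)).trans_le (h1.trans hN.le)

/-- The totally bounded set coded by a sequence of centres and a function `f`. -/
def tube (a : ℕ → X) (f : ℕ → ℕ) : Set X :=
  {z | ∀ n : ℕ, ∃ k ≤ f n, dist z (a k) < 1 / ((n : ℝ) + 1)}

theorem totallyBounded_tube (a : ℕ → X) (f : ℕ → ℕ) : TotallyBounded (tube a f) := by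
  refine Metric.totallyBounded_iff.2 fun ε hε => ?_
  obtain ⟨N, hN⟩ := exists_nat_one_div_lt hε
  refine ⟨a '' Iic (f N), (finite_Iic _).image a, fun z hz => ?_⟩
  obtain ⟨k, hk, h⟩ := hz N
  exact mem_iUnion₂.2 ⟨a k, mem_image_of_mem a hk, h.trans hN⟩

theorem exists_finset_cover_of_totallyBounded {ι : Type*} {K : Set X} (hK : TotallyBounded K)
    {e : ι → X} (he : K ⊆ closure (range e)) {ε : ℝ} (hε : 0 < ε) :
    ∃ F : Finset ι, ∀ z ∈ K, ∃ i ∈ F, dist z (e i) < ε := by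
  classical
  obtain ⟨t, htK, ht, hcov⟩ := Metric.finite_approx_of_totallyBounded hK (ε / 2) (half_pos hε)
  have hex : ∀ y : t, ∃ i, dist (y : X) (e i) < ε / 2 := fun y => by
    obtain ⟨_, ⟨i, rfl⟩, h⟩ := Metric.mem_closure_iff.1 (he (htK y.2)) (ε / 2) (half_pos hε)
    exact ⟨i, h⟩
  choose i hi using hex
  have := ht.fintype
  refine ⟨Finset.univ.image i, fun z hz => ?_⟩
  obtain ⟨y, hy, hzy⟩ := mem_iUnion₂.1 (hcov hz)
  refine ⟨i ⟨y, hy⟩, Finset.mem_image_of_mem i (Finset.mem_univ _), ?_⟩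
  have h1 := dist_triangle z y (e (i ⟨y, hy⟩))
  have h2 := hi ⟨y, hy⟩
  rw [Metric.mem_ball] at hzy
  linarith

/-- A family of totally bounded sets dominating all totally bounded subsets of `U`. -/
theorem exists_dominating_family (U : Set X) :
    ∃ C : Set (Set X),
      #C ≤ Cardinal.lift.{u} dominatingNumber *
        max 1 (Order.cof (CountablyInfiniteSubsets (density U))) ∧
      (∀ c ∈ C, TotallyBounded c) ∧ ∀ K ⊆ U, TotallyBounded K → ∃ c ∈ C, K ⊆ c := by
  have hd : 1 ≤ Cardinal.lift.{u} dominatingNumber := by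
    rw [Cardinal.one_le_iff_ne_zero, Ne, Cardinal.lift_eq_zero]
    exact Order.cof_ne_zero
  -- For finite density the cofinality is `0`, yet one set, `U`, is needed: hence the `max 1`.
  rcases lt_or_ge (density U) ℵ₀ with hκ | hκ
  · refine ⟨{U}, ?_, ?_, fun K hK _ => ⟨U, rfl, hK⟩⟩
    · rw [mk_singleton]
      exact (mul_one (1 : Cardinal.{u})).symm.trans_le (mul_le_mul' hd (le_max_left _ _))
    · rintro _ rfl
      exact (finite_of_density_lt_aleph0 hκ).totallyBounded
  obtain ⟨e, -, he⟩ := exists_range_subset_closure U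
  obtain ⟨𝓐, h𝓐, hA⟩ := Order.exists_cof_eq (α := CountablyInfiniteSubsets (density U))
  obtain ⟨𝓕, h𝓕, hF⟩ := Order.exists_cof_eq (α := ℕ → ℕ)
  refine ⟨range fun p : ULift.{u} 𝓕 × 𝓐 => tube (fun k => e (p.2.1.enum k)) p.1.down.1, ?_, ?_, ?_⟩
  · refine mk_range_le.trans ?_
    rw [← mul_def, mk_uLift, hA, hF]
    exact mul_le_mul_right (le_max_right _ _) _
  · rintro _ ⟨p, rfl⟩
    exact totallyBounded_tube _ _
  · intro K hKU hK
    choose F hFin using fun n : ℕ => exists_finset_cover_of_totallyBounded hK (hKU.trans he)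
      (Nat.one_div_pos_of_nat (α := ℝ) (n := n))
    obtain ⟨A₀, hA₀⟩ := exists_countablyInfiniteSubsets_superset hκ
      (countable_iUnion fun n => (F n).countable_toSet)
    obtain ⟨A, hAm, hAle⟩ := h𝓐 A₀
    have hex : ∀ i : A.1, ∃ k, A.enum k = i := fun i => A.exists_enum_eq i.2
    choose k hk using hex
    have hmem : ∀ n, ∀ i ∈ F n, i ∈ A.1 := fun n i hi => hAle (hA₀ (mem_iUnion.2 ⟨n, hi⟩))
    -- `f n` bounds the positions, in the enumeration of `A`, of the centres used at scale `n`.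
    obtain ⟨f, hfm, hf⟩ := h𝓕 fun n => (F n).attach.sup fun i => k ⟨i.1, hmem n i.1 i.2⟩
    refine ⟨_, ⟨(⟨⟨f, hfm⟩⟩, ⟨A, hAm⟩), rfl⟩, fun z hz n => ?_⟩
    obtain ⟨i, hi, hzi⟩ := hFin n z hz
    refine ⟨k ⟨i, hmem n i hi⟩, le_trans ?_ (hf n), ?_⟩
    · exact Finset.le_sup (f := fun i : F n => k ⟨i.1, hmem n i.1 i.2⟩)
        (Finset.mem_attach (F n) ⟨i, hi⟩)
    · simpa only [hk] using hzi

theorem density_le_cof_precompactSets (h : ℵ₀ ≤ Order.cof (PrecompactSets X)) :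
    density X ≤ Order.cof (PrecompactSets X) := by
  obtain ⟨C, hC, hcard⟩ := Order.exists_cof_eq (α := PrecompactSets X)
  have hsep : ∀ P : PrecompactSets X, ∃ c : Set X, c.Countable ∧ P.1 ⊆ closure c :=
    fun P => P.2.isSeparable
  choose c hc hPc using hsep
  have hd : Dense (⋃ P : C, c P) := fun x => by
    obtain ⟨P, hP, hxP⟩ := hC ⟨{x}, totallyBounded_singleton x⟩
    exact closure_mono (subset_iUnion (fun P : C => c P) ⟨P, hP⟩)
      (hPc P (hxP (mem_singleton x)))
  refine (density_le_mk hd).trans ((mk_iUnion_le _).trans ?_)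
  rw [hcard]
  refine mul_le_of_le h le_rfl ((ciSup_le' fun P => ?_).trans h)
  exact le_aleph0_iff_set_countable.2 (hc P)

end Metric

/-! ### The two Tukey maps and the upper bound -/

section Completion

open UniformSpace

variable {X : Type u} [MetricSpace X]

theorem ball_subset_closure_image_preimage (x : Completion X) (r : ℝ) :
    Metric.ball x r ⊆ closure ((↑) '' ((↑) ⁻¹' Metric.ball x r : Set X)) := by
  rw [image_preimage_eq_inter_range]
  exact Completion.denseRange_coe.open_subset_closure_inter Metric.isOpen_ball

/-- Total boundedness may be tested in the completion, so the centre need not lie in `X`. -/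
theorem totallyBounded_iUnion_of_subset_preimage_ball (x : Completion X) {s : ℕ → Set X}
    (hfin : ∀ n, (s n).Finite)
    (hs : ∀ n, s n ⊆ (↑) ⁻¹' Metric.ball x (1 / ((n : ℝ) + 1))) : TotallyBounded (⋃ n, s n) := by
  rw [← totallyBounded_image_iff (Completion.isUniformInducing_coe X), image_iUnion]
  exact totallyBounded_iUnion_of_subset_ball x (fun n => (hfin n).image _)
    fun n => image_subset_iff.2 (hs n)

theorem exists_forall_nhds_not_isCompact (hX : ¬ LocallyCompactSpace (Completion X)) :
    ∃ x : Completion X, ∀ K ∈ 𝓝 x, ¬ IsCompact K := by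
  by_contra! h
  have : WeaklyLocallyCompactSpace (Completion X) :=
    ⟨fun x => let ⟨K, hK, hc⟩ := h x; ⟨K, hc, hK⟩⟩
  exact hX inferInstance

theorem aleph0_le_localDensity {Y : Type u} [TopologicalSpace Y] [T1Space Y] {x : Y}
    (hx : ∀ K ∈ 𝓝 x, ¬ IsCompact K) : ℵ₀ ≤ localDensity x := by
  by_contra! h
  obtain ⟨U, hU, hd⟩ := exists_nhds_density_eq_localDensity x
  exact hx U hU (finite_of_density_lt_aleph0 (hd ▸ h)).isCompact

/-- No ball around `x` has precompact trace on `X`, so each trace contains an infinite separated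
set. A precompact set contains finitely many of its points, and their largest index bounds the
function coded by initial segments. -/
theorem dominatingNumber_le_cof_precompactSets {x : Completion X}
    (hx : ∀ K ∈ 𝓝 x, ¬ IsCompact K) :
    Cardinal.lift.{u} dominatingNumber ≤ Order.cof (PrecompactSets X) := by
  have hnot : ∀ n : ℕ,
      ¬ TotallyBounded ((↑) ⁻¹' Metric.ball x (1 / ((n : ℝ) + 1)) : Set X) := fun n hn => by
    refine hx (closure ((↑) '' ((↑) ⁻¹' Metric.ball x (1 / ((n : ℝ) + 1)) : Set X))) ?_ ?_
    · exact mem_of_superset (Metric.ball_mem_nhds x Nat.one_div_pos_of_nat)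
        (ball_subset_closure_image_preimage x _)
    · exact (((totallyBounded_image_iff (Completion.isUniformInducing_coe X)).2
        hn).closure).isCompact_of_isClosed isClosed_closure
  choose ε hε S hSA hinf hS using
    fun n => exists_infinite_separated_of_not_totallyBounded (hnot n)
  have hfin : ∀ (P : PrecompactSets X) (n : ℕ),
      {k | ((hinf n).natEmbedding (S n) k : X) ∈ P.1}.Finite := fun P n => by
    refine Set.Finite.of_finite_image (f := fun k => ((hinf n).natEmbedding (S n) k : X))
      ((P.2.finite_inter_of_separated (hε n) (hS n)).subset ?_)
      (Subtype.val_injective.comp ((hinf n).natEmbedding (S n)).injective).injOn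
    rintro _ ⟨k, hk, rfl⟩
    exact ⟨((hinf n).natEmbedding (S n) k).2, hk⟩
  refine (lift_cof_le_of_tukey (α := ℕ → ℕ) (β := PrecompactSets X)
    (fun f => ⟨⋃ n, (fun k => ((hinf n).natEmbedding (S n) k : X)) '' Iic (f n), ?_⟩)
    (fun P n => (hfin P n).toFinset.sup id) ?_).trans_eq (Cardinal.lift_id' _)
  · refine totallyBounded_iUnion_of_subset_preimage_ball x
      (fun n => (finite_Iic _).image _) fun n => ?_
    rintro _ ⟨k, -, rfl⟩
    exact hSA n ((hinf n).natEmbedding (S n) k).2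
  · intro f P h n
    refine Finset.le_sup (f := id) ((hfin P n).mem_toFinset.2 ?_)
    exact h (mem_iUnion.2 ⟨n, mem_image_of_mem _ self_mem_Iic⟩)

/-- Level `n` holds the images of the first `n + 1` elements of `A` only, keeping levels finite; the
`n`th element is recovered at level `n`. A precompact set decodes to countably many indices. -/
theorem cof_countablyInfiniteSubsets_le_cof_precompactSets (x : Completion X) :
    Order.cof (CountablyInfiniteSubsets (localDensity x)) ≤ Order.cof (PrecompactSets X) := by
  rcases lt_or_ge (localDensity x) ℵ₀ with hκ | hκ
  · have := isEmpty_countablyInfiniteSubsets hκ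
    simp
  choose D hDA hAD hD using fun n : ℕ => exists_subset_closure_countable_inter
    ((↑) ⁻¹' Metric.ball x (1 / ((n : ℝ) + 1)) : Set X)
  have hcard : ∀ n, #(localDensity x).out ≤ #(D n) := fun n => by
    rw [mk_out]
    refine (localDensity_le_density (Metric.ball_mem_nhds x
      (Nat.one_div_pos_of_nat (n := n)))).trans
      ((density_coe_le_mk_of_subset_closure (s := (↑) '' D n) ?_ ?_).trans mk_image_le)
    · exact image_subset_iff.2 (hDA n)
    · refine (ball_subset_closure_image_preimage x _).trans (closure_minimal ?_ isClosed_closure)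
      exact (image_mono (hAD n)).trans
        (image_closure_subset_closure_image (Completion.continuous_coe X))
  have hemb : ∀ n, Nonempty ((localDensity x).out ↪ D n) := fun n => Cardinal.le_def _ _ |>.1 (hcard n)
  have hcount : ∀ P : PrecompactSets X,
      (⋃ n, {i | ((hemb n).some i : X) ∈ P.1}).Countable := fun P => by
    refine countable_iUnion fun n => ?_
    refine ((hD n P.1 P.2).preimage_of_injOn (f := fun i => ((hemb n).some i : X))
      (Subtype.val_injective.comp (hemb n).some.injective).injOn).mono fun i hi => ?_
    exact ⟨((hemb n).some i).2, hi⟩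
  choose g hg using fun P => exists_countablyInfiniteSubsets_superset hκ (hcount P)
  have key := lift_cof_le_of_tukey (α := CountablyInfiniteSubsets (localDensity x))
    (β := PrecompactSets X)
    (fun A => ⟨⋃ n, (fun k => ((hemb n).some (A.enum k) : X)) '' Iic n,
      totallyBounded_iUnion_of_subset_preimage_ball x (fun n => (finite_Iic _).image _)
        fun n => by
          rintro _ ⟨k, -, rfl⟩
          exact hDA n ((hemb n).some (A.enum k)).2⟩) g ?_
  · simpa only [Cardinal.lift_id] using key
  · intro A P h i hi
    obtain ⟨n, rfl⟩ := A.exists_enum_eq hi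
    exact hg P (mem_iUnion.2 ⟨n, h (mem_iUnion.2 ⟨n, mem_image_of_mem _ self_mem_Iic⟩)⟩)

theorem cof_precompactSets_le {s : Cardinal.{u}} (hs : 1 ≤ s)
    (hcof : ∀ x : Completion X, Order.cof (CountablyInfiniteSubsets (localDensity x)) ≤ s)
    (hd : 1 ≤ density X) :
    Order.cof (PrecompactSets X) ≤ density X * Cardinal.lift.{u} dominatingNumber * s := by
  have h𝔡 : ℵ₀ ≤ Cardinal.lift.{u} dominatingNumber := by
    rw [Cardinal.aleph0_le_lift]
    exact aleph0_le_dominatingNumber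
  set μ := density X * Cardinal.lift.{u} dominatingNumber * s with hμ
  have h𝔡s : Cardinal.lift.{u} dominatingNumber * s ≤ μ := by
    rw [hμ, mul_assoc]
    exact le_mul_of_one_le_left' hd
  have hμ₀ : ℵ₀ ≤ μ := (h𝔡.trans (le_mul_of_one_le_right' hs)).trans h𝔡s
  have hdμ : density X ≤ μ := by
    rw [hμ, mul_assoc]
    exact le_mul_of_one_le_right' (one_le_aleph0.trans (h𝔡.trans (le_mul_of_one_le_right' hs)))
  obtain ⟨D, hD, hDcard⟩ := exists_dense_mk_eq_density X
  choose U hU hUd using fun x : Completion X => exists_nhds_density_eq_localDensity x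
  have hloc : ∀ p : D × ℕ, ∃ C : Set (Set (Completion X)), #C ≤ μ ∧
      (∀ c ∈ C, TotallyBounded c) ∧
      ∀ x, Metric.ball (p.1 : Completion X) (1 / ((p.2 : ℝ) + 1)) ⊆ U x →
        ∀ K ⊆ Metric.ball (p.1 : Completion X) (1 / ((p.2 : ℝ) + 1)), TotallyBounded K →
          ∃ c ∈ C, K ⊆ c := by
    intro p
    by_cases hp : ∃ x, Metric.ball (p.1 : Completion X) (1 / ((p.2 : ℝ) + 1)) ⊆ U x
    · obtain ⟨x, hx⟩ := hp
      obtain ⟨C, hC, hCtb, hdom⟩ := exists_dominating_family (U x)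
      refine ⟨C, hC.trans ((mul_le_mul_right (max_le hs ?_) _).trans h𝔡s), hCtb,
        fun _ _ K hK => hdom K (hK.trans hx)⟩
      rw [hUd]
      exact hcof x
    · exact ⟨∅, by simp, by simp, fun x hx => (hp ⟨x, hx⟩).elim⟩
  choose C hC hCtb hdom using hloc
  have hT : #(⋃ p, C p) ≤ μ := by
    refine (mk_iUnion_le _).trans (mul_le_of_le hμ₀ ?_ (ciSup_le' hC))
    simpa [hDcard] using mul_le_of_le hμ₀ hdμ hμ₀
  -- Passing to finite subfamilies does not exceed the infinite bound `μ`.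
  have hFin : #(Finset (⋃ p, C p : Set (Set (Completion X)))) ≤ μ := by
    cases finite_or_infinite (⋃ p, C p : Set (Set (Completion X)))
    · exact (lt_aleph0_of_finite _).le.trans hμ₀
    · rwa [mk_finset_of_infinite]
  have htb : ∀ F : Finset (⋃ p, C p : Set (Set (Completion X))),
      TotallyBounded ((↑) ⁻¹' (⋃ t ∈ F, t.1) : Set X) := fun F => by
    refine totallyBounded_preimage (Completion.isUniformInducing_coe X) ?_
    refine (totallyBounded_biUnion F.finite_toSet).2 fun t _ => ?_
    obtain ⟨p, hp⟩ := mem_iUnion.1 t.2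
    exact hCtb p t.1 hp
  refine (Order.cof_le (s := range fun F => (⟨_, htb F⟩ : PrecompactSets X)) ?_).trans
    (mk_range_le.trans hFin)
  intro P
  set K : Set (Completion X) := closure ((↑) '' P.1) with hKdef
  have hK : IsCompact K := (((totallyBounded_image_iff (Completion.isUniformInducing_coe X)).2
        P.2).closure).isCompact_of_isClosed isClosed_closure
  have hcover : ∀ y : Completion X, ∃ p : D × ℕ,
      (∃ x, Metric.ball (p.1 : Completion X) (1 / ((p.2 : ℝ) + 1)) ⊆ U x) ∧
        y ∈ Metric.ball (p.1 : Completion X) (1 / ((p.2 : ℝ) + 1)) := by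
    intro y
    obtain ⟨r, hr, hrU⟩ := Metric.mem_nhds_iff.1 (hU y)
    -- Radius below `r / 2` keeps any such ball containing `y` inside the `r`-ball around `y`.
    obtain ⟨n, hn⟩ := exists_nat_one_div_lt (half_pos hr)
    have hD' : Dense ((↑) '' D : Set (Completion X)) :=
      Completion.denseRange_coe.dense_image (Completion.continuous_coe X) hD
    obtain ⟨_, ⟨q, hq, rfl⟩, hyq⟩ := hD'.exists_dist_lt y (Nat.one_div_pos_of_nat (α := ℝ) (n := n))
    refine ⟨(⟨q, hq⟩, n), ⟨y, fun z hz => hrU ?_⟩, hyq⟩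
    have h1 := dist_triangle_right z y (q : Completion X)
    rw [Metric.mem_ball] at hz ⊢
    dsimp only at hz
    linarith
  choose p hp hyp using hcover
  obtain ⟨t, -, ht⟩ := hK.elim_nhds_subcover
    (fun y => Metric.ball ((p y).1 : Completion X) (1 / (((p y).2 : ℝ) + 1)))
    fun y _ => Metric.isOpen_ball.mem_nhds (hyp y)
  have hc : ∀ y, ∃ c ∈ C (p y),
      K ∩ Metric.ball ((p y).1 : Completion X) (1 / (((p y).2 : ℝ) + 1)) ⊆ c := fun y => by
    obtain ⟨x, hx⟩ := hp y
    exact hdom (p y) x hx _ inter_subset_right (hK.totallyBounded.subset inter_subset_left)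
  choose c hcC hKc using hc
  classical
  refine ⟨_, ⟨t.image fun y => ⟨c y, mem_iUnion.2 ⟨p y, hcC y⟩⟩, rfl⟩, fun z hz => ?_⟩
  have hzK : (z : Completion X) ∈ K := subset_closure (mem_image_of_mem _ hz)
  obtain ⟨y, hy, hzy⟩ := mem_iUnion₂.1 (ht hzK)
  exact mem_iUnion₂.2 ⟨⟨c y, mem_iUnion.2 ⟨p y, hcC y⟩⟩, Finset.mem_image_of_mem _ hy,
    hKc y ⟨hzK, hzy⟩⟩

end Completion

/-! ### The cofinality formula -/

theorem mainTheorem3 (X : Type u) [MetricSpace X]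
    (hX : ¬ LocallyCompactSpace (UniformSpace.Completion X)) :
    Order.cof (PrecompactSets X) =
      density X * Cardinal.lift.{u} dominatingNumber *
        ⨆ x : UniformSpace.Completion X,
          Order.cof (CountablyInfiniteSubsets (localDensity x)) := by
  obtain ⟨x, hx⟩ := exists_forall_nhds_not_isCompact hX
  have h𝔡 := dominatingNumber_le_cof_precompactSets hx
  have h₀ : ℵ₀ ≤ Order.cof (PrecompactSets X) := by
    refine le_trans ?_ h𝔡
    rw [Cardinal.aleph0_le_lift]
    exact aleph0_le_dominatingNumber
  have hle : ∀ y : UniformSpace.Completion X,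
      Order.cof (CountablyInfiniteSubsets (localDensity y)) ≤
        ⨆ x : UniformSpace.Completion X,
          Order.cof (CountablyInfiniteSubsets (localDensity x)) :=
    le_ciSup (bddAbove_of_small)
  refine le_antisymm (cof_precompactSets_le ?_ hle ?_)
    (mul_le_of_le h₀ (mul_le_of_le h₀ (density_le_cof_precompactSets h₀) h𝔡)
      (ciSup_le' cof_countablyInfiniteSubsets_le_cof_precompactSets))
  · refine le_trans ?_ (hle x)
    obtain ⟨A, -⟩ := exists_countablyInfiniteSubsets_superset (aleph0_le_localDensity hx)
      countable_empty
    have : Nonempty (CountablyInfiniteSubsets (localDensity x)) := ⟨A⟩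
    exact Cardinal.one_le_iff_ne_zero.2 Order.cof_ne_zero
  · obtain ⟨D, hD, hcard⟩ := exists_dense_mk_eq_density X
    have : Nonempty X := (UniformSpace.Completion.nonempty_completion_iff X).1 ⟨x⟩
    rw [← hcard, Cardinal.one_le_iff_ne_zero, Cardinal.mk_ne_zero_iff]
    exact hD.nonempty.to_subtype
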